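/- Equip the circle $\mathbb T=\mathbb R/2\pi\mathbb Z$ with the normalized measure $d\theta/2\pi$. A weight is a nonnegative $w\in L^1(\mathbb T)$ that is positive on a set of positive measure; $L^2(w)$ is the $L^2$-space of the measure $w\,d\theta/2\pi$, and $H^2(w)$ is the closed linear span in $L^2(w)$ of the functions $e_n(\theta)=e^{in\theta}$, $n\ge 0$. The weight $w$ is an $A_2$-weight if there is a bounded projection $R$ of $L^2(w)$ onto $H^2(w)$ with $R(e^{in\theta})=0$ for all $n<0$. Two weights $v,w$ are equivalent, $v\sim w$, if $v/w$ and $w/v$ belong to $L^\infty(\mathbb T)$. Let $w$ be an $A_2$-weight and let $(\lambda_n)_{n\ge 0}$ be an increasing (not necessarily strictly increasing) real sequence with $0\le\lambda_n<1$ for all $n$ and $$\lim_{n\to\infty}\frac{1-\lambda_{n+1}}{1-\lambda_n}=0 .$$ Let $T:H^2(w)\to H^2(w)$ be the corresponding fast monotone multiplier, that is, the bounded linear operator with $$T\Big(\sum_{n=0}^\infty a_ne_n\Big)=\sum_{n=0}^\infty\lambda_na_ne_n$$ for every norm convergent series $\sum_{n\ge 0} a_ne_n$ in $H^2(w)$.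 Then the following are equivalent: (i) $T$ is similar to a contraction, i.e. there is a bounded invertible operator $A$ on $H^2(w)$ with $\|A^{-1}TA\|\le 1$; (ii) $T$ is polynomially bounded, i.e. there is a constant $C$ such that $\|p(T)\|\le C\sup_{|z|\le 1}|p(z)|$ for every complex polynomial $p$; (iii) $w\sim 1$, where $1$ denotes the constant weight. -/

import Mathlib

open MeasureTheory Filter Topology AddCircle
open scoped ENNReal Polynomial

noncomputable section

instance factTwoPiPos : Fact (0 < 2 * Real.pi) := ⟨Real.two_pi_pos⟩

/-- The circle, as `ℝ / 2πℤ`. Below it carries the normalized Haar measure `haarAddCircle`,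
that is `dθ / 2π`, and `fourier n` is the function `θ ↦ e ^ (i n θ)`. -/
abbrev CircleT : Type := AddCircle (2 * Real.pi)

/-- A weight on the circle: a nonnegative function in `L¹` which is positive on a set of
positive measure. -/
structure Weight where
  toFun : CircleT → ℝ
  integrable : Integrable toFun (haarAddCircle : Measure CircleT)
  nonneg : ∀ᵐ θ ∂(haarAddCircle : Measure CircleT), 0 ≤ toFun θ
  pos : 0 < (haarAddCircle : Measure CircleT) {θ | 0 < toFun θ}

namespace Weight

instance : CoeFun Weight (fun _ => CircleT → ℝ) := ⟨Weight.toFun⟩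

/-- The constant weight `1`. -/
instance : One Weight where
  one :=
    { toFun := fun _ => 1
      integrable := integrable_const 1
      nonneg := Eventually.of_forall fun _ => zero_le_one
      pos := by simp }

/-- The measure `w dθ / 2π`. -/
def measure (w : Weight) : Measure CircleT :=
  (haarAddCircle : Measure CircleT).withDensity fun θ => ENNReal.ofReal (w θ)

instance (w : Weight) : IsFiniteMeasure w.measure :=
  isFiniteMeasure_withDensity_ofReal w.integrable.2

/-- The weighted space `L²(w)`. -/
abbrev L2 (w : Weight) : Type := Lp ℂ 2 w.measure

/-- The exponential `e ^ (i n θ)` as an element of `L²(w)`. -/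
def expL2 (w : Weight) (n : ℤ) : w.L2 :=
  ContinuousMap.toLp 2 w.measure ℂ (fourier n : C(CircleT, ℂ))

/-- `H²(w)`: the closed linear span in `L²(w)` of the exponentials `e ^ (i n θ)`, `n ≥ 0`. -/
def H2 (w : Weight) : Submodule ℂ w.L2 :=
  (Submodule.span ℂ (Set.range fun n : ℕ => w.expL2 n)).topologicalClosure

/-- The exponential `e ^ (i n θ)`, `n ≥ 0`, as an element of `H²(w)`. -/
def expH2 (w : Weight) (n : ℕ) : w.H2 :=
  ⟨w.expL2 n, Submodule.le_topologicalClosure _ (Submodule.subset_span ⟨n, rfl⟩)⟩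

/-- `w` is an `A₂`-weight: there is a bounded projection `R` of `L²(w)` onto `H²(w)` with
`R (e ^ (i n θ)) = 0` for every `n < 0`. -/
def IsA2 (w : Weight) : Prop :=
  ∃ R : w.L2 →L[ℂ] w.L2, IsIdempotentElem R ∧
    LinearMap.range (R : w.L2 →ₗ[ℂ] w.L2) = w.H2 ∧ ∀ n : ℤ, n < 0 → R (w.expL2 n) = 0

/-- Equivalence of weights: `v / w` and `w / v` are in `L^∞`. As division by zero gives zero
in Lean, the first clause records that neither quotient has a nonzero numerator over a zero
denominator, except on a null set. -/
def Equivalent (v w : Weight) : Prop :=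
  (∀ᵐ θ ∂(haarAddCircle : Measure CircleT), v θ = 0 ↔ w θ = 0) ∧
    MemLp (fun θ => v θ / w θ) ∞ (haarAddCircle : Measure CircleT) ∧
    MemLp (fun θ => w θ / v θ) ∞ (haarAddCircle : Measure CircleT)

end Weight

section Operators

variable {H : Type*} [NormedAddCommGroup H] [NormedSpace ℂ H]

/-- `T` is the monotone multiplier with respect to `e` that corresponds to the increasing
sequence `lam` in `[0, 1]`: it maps `∑ aₖ eₖ` to `∑ lamₖ aₖ eₖ`. The series are limits of
their partial sums in the natural order. -/
structure IsMonotoneMultiplier (e : ℕ → H) (lam : ℕ → ℝ) (T : H →L[ℂ] H) : Prop where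
  monotone : Monotone lam
  nonneg : ∀ k, 0 ≤ lam k
  le_one : ∀ k, lam k ≤ 1
  map_series : ∀ (a : ℕ → ℂ) (x : H),
    Tendsto (fun n => ∑ k ∈ Finset.range n, a k • e k) atTop (𝓝 x) →
    Tendsto (fun n => ∑ k ∈ Finset.range n, ((lam k : ℂ) * a k) • e k) atTop (𝓝 (T x))

/-- A fast monotone multiplier: moreover `lamₖ < 1` for every `k`, and
`(1 - lamₖ₊₁) / (1 - lamₖ)` tends to `0`. -/
structure IsFastMonotoneMultiplier (e : ℕ → H) (lam : ℕ → ℝ) (T : H →L[ℂ] H) : Prop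
    extends IsMonotoneMultiplier e lam T where
  lt_one : ∀ k, lam k < 1
  fast : Tendsto (fun k => (1 - lam (k + 1)) / (1 - lam k)) atTop (𝓝 0)

/-- `T` is similar to a contraction: `‖A⁻¹ T A‖ ≤ 1` for some bounded invertible `A`. -/
def IsSimilarToContraction (T : H →L[ℂ] H) : Prop :=
  ∃ A : H ≃L[ℂ] H, ‖(A.symm : H →L[ℂ] H) ∘L T ∘L (A : H →L[ℂ] H)‖ ≤ 1

/-- `T` is polynomially bounded: there is a constant `C` such that `‖p(T)‖` is at most `C`
times the supremum of `|p|` over the closed unit disc, for every complex polynomial `p`. -/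
def IsPolynomiallyBounded (T : H →L[ℂ] H) : Prop :=
  ∃ C : ℝ, ∀ p : ℂ[X],
    ‖Polynomial.aeval T p‖ ≤ C * ⨆ z : Metric.closedBall (0 : ℂ) 1, ‖p.eval (z : ℂ)‖

end Operators

end

/-! ### Von Neumann's inequality -/

section VonNeumann

variable {H : Type*} [NormedAddCommGroup H] [InnerProductSpace ℂ H]

/-! The operator is diagonal on the exponentials, `T eₙ = λₙ eₙ`, so everything turns on whether the
exponentials form a Riesz basis of `H²(w)`.

A contraction satisfies von Neumann's inequality (`norm_aeval_le_of_norm_le_one`), and conjugation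
costs only a constant, so (i) gives (ii).

For (ii) ⇒ (iii), the numbers `1 - λₙ` eventually decay so fast that products of Blaschke factors,
with zeros placed in the gaps where the sign should change, nearly interpolate any pattern of signs
at the `λₙ` (`exists_isDiscLimit_signs`). Polynomial boundedness then bounds all sign changes of a
tail of the exponentials uniformly (`norm_sum_isSign_le`). In a Hilbert space the parallelogram law
turns this into two-sided `ℓ²` estimates. By Parseval these compare the norms of `L²(w)` and `L²` on
analytic polynomials of high frequency. Multiplication by an exponential leaves `|f|` unchanged, so
the comparison holds for all trigonometric polynomials, then for continuous functions, then for the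
measures of sets; hence `w` is bounded above and away from zero.

For (iii) ⇒ (i), an equivalent norm makes the exponentials a Riesz basis, and the map from an
orthonormal basis to it conjugates `T` to a diagonal contraction
(`isSimilarToContraction_of_rieszBasis`). -/

theorem integral_fourier_haar (n : ℤ) :
    ∫ θ : CircleT, fourier n θ ∂haarAddCircle = if n = 0 then 1 else 0 := by
  have h := congrFun (fourierCoeff_fourier (T := 2 * Real.pi) n) 0
  simpa [fourierCoeff, Pi.single_apply, eq_comm] using h

theorem integrable_haar_of_continuous {E : Type*} [NormedAddCommGroup E] {f : CircleT → E}
    (hf : Continuous f) : Integrable f (haarAddCircle : Measure CircleT) :=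
  hf.integrable_of_hasCompactSupport (HasCompactSupport.of_compactSpace f)

/-- Parseval's identity for trigonometric polynomials with values in a Hilbert space. -/
theorem integral_norm_sq_trigPoly (s : Finset ℤ) (y : ℤ → H) :
    ∫ θ : CircleT, ‖∑ k ∈ s, fourier k θ • y k‖ ^ 2 ∂haarAddCircle = ∑ k ∈ s, ‖y k‖ ^ 2 := by
  have hpt : ∀ θ : CircleT, ((‖∑ k ∈ s, fourier k θ • y k‖ ^ 2 : ℝ) : ℂ) =
      ∑ j ∈ s, ∑ k ∈ s, fourier (k - j) θ * inner ℂ (y j) (y k) := by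
    intro θ
    have h := inner_self_eq_norm_sq_to_K (𝕜 := ℂ) (∑ k ∈ s, fourier k θ • y k)
    push_cast at h ⊢
    rw [← Complex.coe_algebraMap]
    erw [← h]
    rw [sum_inner]
    refine Finset.sum_congr rfl fun j _ => ?_
    rw [inner_sum]
    refine Finset.sum_congr rfl fun k _ => ?_
    rw [inner_smul_left, inner_smul_right, sub_eq_neg_add, fourier_add, fourier_neg, mul_assoc]
  have hc : ((∫ θ : CircleT, ‖∑ k ∈ s, fourier k θ • y k‖ ^ 2 ∂haarAddCircle : ℝ) : ℂ) =
      ((∑ k ∈ s, ‖y k‖ ^ 2 : ℝ) : ℂ) := by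
    rw [← integral_complex_ofReal]
    simp_rw [hpt]
    rw [integral_finsetSum _ fun j _ => integrable_haar_of_continuous (by fun_prop)]
    push_cast
    refine Finset.sum_congr rfl fun j hj => ?_
    rw [integral_finsetSum _ fun k _ => integrable_haar_of_continuous (by fun_prop)]
    simp_rw [integral_mul_const, integral_fourier_haar, sub_eq_zero]
    simp only [ite_mul, one_mul, zero_mul, Finset.sum_ite_eq', hj, if_true]
    exact inner_self_eq_norm_sq_to_K _
  exact_mod_cast hc

theorem sum_norm_sq_defect (T : H →L[ℂ] H) (x : H) (L : ℕ) :
    ∑ k ∈ Finset.range L, (‖(T ^ k) x‖ ^ 2 - ‖T ((T ^ k) x)‖ ^ 2) =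
      ‖x‖ ^ 2 - ‖(T ^ L) x‖ ^ 2 := by
  have h := Finset.sum_range_sub' (fun k => ‖(T ^ k) x‖ ^ 2) L
  simpa [pow_succ'] using h

theorem integral_defect_trigPoly (T : H →L[ℂ] H) (s : Finset ℤ) (y : ℤ → H) :
    ∫ θ : CircleT, (‖∑ k ∈ s, fourier k θ • y k‖ ^ 2 - ‖T (∑ k ∈ s, fourier k θ • y k)‖ ^ 2)
      ∂haarAddCircle = ∑ k ∈ s, (‖y k‖ ^ 2 - ‖T (y k)‖ ^ 2) := by
  rw [integral_sub (integrable_haar_of_continuous (by fun_prop))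
    (integrable_haar_of_continuous (by fun_prop)), integral_norm_sq_trigPoly,
    Finset.sum_sub_distrib, ← integral_norm_sq_trigPoly s fun k => T (y k)]
  simp

/-- The defect `Q(v) = ‖v‖² - ‖Tv‖²` is a nonnegative quadratic form whose integral over a
trigonometric polynomial is the sum of its values at the coefficients. For `y(θ) = ∑ e^(-ikθ) Tᵏx`,
pointwise `Q(p(e^(iθ)) y) ≤ M² Q(y)`. After integration the right side telescopes, and so do the
terms on the left of frequency `-l` with `l < L`. -/
theorem norm_aeval_apply_sq_sub_le (T : H →L[ℂ] H) (hT : ‖T‖ ≤ 1) (p : ℂ[X]) (M : ℝ)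
    (hM : ∀ z : ℂ, ‖z‖ = 1 → ‖p.eval z‖ ≤ M) (x : H) (L : ℕ) :
    ‖(Polynomial.aeval T p) x‖ ^ 2 - ‖(T ^ L) ((Polynomial.aeval T p) x)‖ ^ 2 ≤
      M ^ 2 * ‖x‖ ^ 2 := by
  set d := p.natDegree + 1 with hd
  have hQ : ∀ y : H, 0 ≤ ‖y‖ ^ 2 - ‖T y‖ ^ 2 := fun y => by
    have : ‖T y‖ ≤ ‖y‖ := by simpa using T.le_of_opNorm_le hT y
    have := pow_le_pow_left₀ (norm_nonneg _) this 2
    linarith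
  -- The pair `(m, k)` carries the term `p.coeff m • Tᵏ x` at frequency `m - k`. Keeping all `k < L
  -- + d` ensures that for `l < L` every `k = l + m` with `m ≤ deg p` occurs, so the coefficient at
  -- `-l` is exactly `Tˡ p(T) x`.
  let I : Finset (ℕ × ℕ) := Finset.range d ×ˢ Finset.range (L + d)
  let φ : ℕ × ℕ → ℤ := fun q => q.1 - q.2
  let z : ℤ → H := fun l => ∑ q ∈ I with φ q = l, p.coeff q.1 • (T ^ q.2) x
  let s : Finset ℤ := (Finset.range (L + d)).image fun k : ℕ => -(k : ℤ)
  let y : ℤ → H := fun l => (T ^ (-l).toNat) x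
  have hinj : Function.Injective fun k : ℕ => -(k : ℤ) := fun a b h => by simpa using h
  have hmul : ∀ θ : CircleT, p.eval (fourier 1 θ) • ∑ k ∈ s, fourier k θ • y k =
      ∑ l ∈ I.image φ, fourier l θ • z l := by
    intro θ
    have h1 : ∀ l ∈ I.image φ, fourier l θ • z l =
        ∑ q ∈ I with φ q = l, fourier (φ q) θ • p.coeff q.1 • (T ^ q.2) x := by
      intro l _
      rw [Finset.smul_sum]
      refine Finset.sum_congr rfl fun q hq => ?_
      rw [(Finset.mem_filter.1 hq).2]
    rw [Finset.sum_congr rfl h1,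
      Finset.sum_fiberwise_of_maps_to fun q hq => Finset.mem_image_of_mem _ hq,
      Finset.sum_product, Polynomial.eval_eq_sum_range, Finset.sum_smul]
    refine Finset.sum_congr rfl fun m _ => ?_
    rw [Finset.sum_image fun a _ b _ h => hinj h, Finset.smul_sum]
    refine Finset.sum_congr rfl fun k _ => ?_
    have : (fourier 1 θ : ℂ) ^ m = fourier (m : ℤ) θ := by
      simp [fourier_apply, toCircle_nsmul]
    simp only [φ, y, neg_neg, Int.toNat_natCast, smul_smul]
    rw [this, sub_eq_add_neg, fourier_add]
    congr 1
    ring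
  have hz : ∀ l ∈ Finset.range L, z (-(l : ℤ)) = (T ^ l) ((Polynomial.aeval T p) x) := by
    intro l hl
    have hl := Finset.mem_range.1 hl
    simp only [z, Finset.sum_filter, I, Finset.sum_product]
    rw [Polynomial.aeval_eq_sum_range]
    simp only [sum_apply, map_sum, smul_apply, map_smul]
    refine Finset.sum_congr rfl fun m hm => ?_
    have hm := Finset.mem_range.1 hm
    rw [Finset.sum_eq_single (l + m)]
    · simp only [φ]
      rw [if_pos (by push_cast; ring), pow_add, mul_apply_eq_comp]
    · intro k _ hk
      refine if_neg fun h => hk ?_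
      simp only [φ] at h
      omega
    · intro h
      exact absurd (Finset.mem_range.2 (by omega)) h
  have hM0 : 0 ≤ M := (norm_nonneg _).trans (hM 1 norm_one)
  calc ‖(Polynomial.aeval T p) x‖ ^ 2 - ‖(T ^ L) ((Polynomial.aeval T p) x)‖ ^ 2
      = ∑ l ∈ (Finset.range L).image fun k : ℕ => -(k : ℤ), (‖z l‖ ^ 2 - ‖T (z l)‖ ^ 2) := by
        rw [← sum_norm_sq_defect, Finset.sum_image fun a _ b _ h => hinj h]
        exact Finset.sum_congr rfl fun l hl => by rw [hz l hl]
    -- The remaining frequencies only add nonnegative defects.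
    _ ≤ ∑ l ∈ I.image φ, (‖z l‖ ^ 2 - ‖T (z l)‖ ^ 2) := by
        refine Finset.sum_le_sum_of_subset_of_nonneg ?_ fun l _ _ => hQ _
        intro l hl
        obtain ⟨k, hk, rfl⟩ := Finset.mem_image.1 hl
        have hk := Finset.mem_range.1 hk
        refine Finset.mem_image.2 ⟨(0, k), ?_, by simp [φ]⟩
        simp only [I, Finset.mem_product, Finset.mem_range]
        omega
    _ = ∫ θ : CircleT, (‖p.eval (fourier 1 θ) • ∑ k ∈ s, fourier k θ • y k‖ ^ 2 -
          ‖T (p.eval (fourier 1 θ) • ∑ k ∈ s, fourier k θ • y k)‖ ^ 2) ∂haarAddCircle := by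
        rw [← integral_defect_trigPoly]
        simp_rw [hmul]
    _ ≤ ∫ θ : CircleT, M ^ 2 * (‖∑ k ∈ s, fourier k θ • y k‖ ^ 2 -
          ‖T (∑ k ∈ s, fourier k θ • y k)‖ ^ 2) ∂haarAddCircle := by
        refine integral_mono (integrable_haar_of_continuous (by fun_prop))
          (integrable_haar_of_continuous (by fun_prop)) fun θ => ?_
        simp only [map_smul, norm_smul, mul_pow]
        rw [← mul_sub]
        refine mul_le_mul_of_nonneg_right (pow_le_pow_left₀ (norm_nonneg _) (hM _ ?_) 2) (hQ _)
        exact (congrArg norm fourier_one).trans (Circle.norm_coe _)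
    _ = M ^ 2 * (‖x‖ ^ 2 - ‖(T ^ (L + d)) x‖ ^ 2) := by
        rw [integral_const_mul, integral_defect_trigPoly, ← sum_norm_sq_defect,
          Finset.sum_image fun a _ b _ h => hinj h]
        simp [y]
    _ ≤ M ^ 2 * ‖x‖ ^ 2 := by
        refine mul_le_mul_of_nonneg_left ?_ (sq_nonneg _)
        linarith [sq_nonneg ‖(T ^ (L + d)) x‖]

theorem norm_aeval_le_of_norm_lt_one (T : H →L[ℂ] H) (hT : ‖T‖ < 1) (p : ℂ[X]) (M : ℝ)
    (hM : ∀ z : ℂ, ‖z‖ = 1 → ‖p.eval z‖ ≤ M) : ‖Polynomial.aeval T p‖ ≤ M := by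
  have hM0 : 0 ≤ M := (norm_nonneg _).trans (hM 1 norm_one)
  refine ContinuousLinearMap.opNorm_le_bound _ hM0 fun x => ?_
  refine le_of_sq_le_sq ?_ (by positivity)
  have h0 : Tendsto (fun L : ℕ => (T ^ L) ((Polynomial.aeval T p) x)) atTop (𝓝 0) := by
    have := ((ContinuousLinearMap.apply ℂ H ((Polynomial.aeval T p) x)).continuous.tendsto 0).comp
      (tendsto_pow_atTop_nhds_zero_of_norm_lt_one hT)
    simpa [Function.comp_def] using this
  have h1 := tendsto_const_nhds (x := ‖(Polynomial.aeval T p) x‖ ^ 2).sub (h0.norm.pow 2)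
  rw [mul_pow]
  simpa using le_of_tendsto h1
    (Eventually.of_forall fun L => norm_aeval_apply_sq_sub_le T hT.le p M hM x L)

/-- Von Neumann's inequality. -/
theorem norm_aeval_le_of_norm_le_one (T : H →L[ℂ] H) (hT : ‖T‖ ≤ 1) (p : ℂ[X]) (M : ℝ)
    (hM : ∀ z : ℂ, ‖z‖ = 1 → ‖p.eval z‖ ≤ M) : ‖Polynomial.aeval T p‖ ≤ M := by
  have hc : Continuous fun r : ℝ => ‖Polynomial.aeval ((r : ℂ) • T) p‖ := by
    have := p.continuous_aeval (A := H →L[ℂ] H)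
    fun_prop
  have h1 : Tendsto (fun r : ℝ => ‖Polynomial.aeval ((r : ℂ) • T) p‖) (𝓝[<] 1)
      (𝓝 ‖Polynomial.aeval T p‖) := by
    simpa using (hc.tendsto 1).mono_left nhdsWithin_le_nhds
  refine le_of_tendsto h1 ?_
  filter_upwards [Ioo_mem_nhdsLT (show (0 : ℝ) < 1 by norm_num)] with r hr
  refine norm_aeval_le_of_norm_lt_one _ ?_ p M hM
  rw [norm_smul, Complex.norm_real, Real.norm_of_nonneg hr.1.le]
  nlinarith [hr.1, hr.2, norm_nonneg T]

theorem norm_eval_le_iSup_closedBall (p : ℂ[X]) {z : ℂ} (hz : ‖z‖ ≤ 1) :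
    ‖p.eval z‖ ≤ ⨆ z : Metric.closedBall (0 : ℂ) 1, ‖p.eval (z : ℂ)‖ := by
  have hb : BddAbove (Set.range fun z : Metric.closedBall (0 : ℂ) 1 => ‖p.eval (z : ℂ)‖) :=
    (isCompact_range (by fun_prop)).bddAbove
  exact le_ciSup hb ⟨z, by simpa using hz⟩

theorem IsSimilarToContraction.isPolynomiallyBounded {T : H →L[ℂ] H}
    (h : IsSimilarToContraction T) : IsPolynomiallyBounded T := by
  obtain ⟨A, hA⟩ := h
  set S : H →L[ℂ] H := (A.symm : H →L[ℂ] H) ∘L T ∘L (A : H →L[ℂ] H) with hS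
  refine ⟨‖(A : H →L[ℂ] H)‖ * ‖(A.symm : H →L[ℂ] H)‖, fun p => ?_⟩
  have hconj : Polynomial.aeval T p =
      (A : H →L[ℂ] H) ∘L Polynomial.aeval S p ∘L (A.symm : H →L[ℂ] H) := by
    induction p using Polynomial.induction_on' with
    | add p q hp hq => simp [hp, hq, ContinuousLinearMap.add_comp, ContinuousLinearMap.comp_add]
    | monomial n a =>
      have hpow : T ^ n = (A : H →L[ℂ] H) ∘L (S ^ n : H →L[ℂ] H) ∘L (A.symm : H →L[ℂ] H) := by
        induction n with
        | zero => ext x; simp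
        | succ n ih => rw [pow_succ, ih, pow_succ]; ext x; simp [hS]
      rw [Polynomial.aeval_monomial, Polynomial.aeval_monomial, hpow]
      ext x
      simp
  have hv := norm_aeval_le_of_norm_le_one S hA p _
    fun z hz => norm_eval_le_iSup_closedBall p hz.le
  calc ‖Polynomial.aeval T p‖
      ≤ ‖(A : H →L[ℂ] H)‖ * (‖Polynomial.aeval S p‖ * ‖(A.symm : H →L[ℂ] H)‖) := by
        rw [hconj]
        refine (ContinuousLinearMap.opNorm_comp_le _ _).trans ?_
        gcongr
        exact ContinuousLinearMap.opNorm_comp_le _ _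
    _ ≤ ‖(A : H →L[ℂ] H)‖ * ((⨆ z : Metric.closedBall (0 : ℂ) 1, ‖p.eval (z : ℂ)‖) *
          ‖(A.symm : H →L[ℂ] H)‖) := by gcongr
    _ = _ := by ring

end VonNeumann

/-! ### Sign changes and square sums in inner product spaces -/

section Signs

variable {H : Type*} [NormedAddCommGroup H] [InnerProductSpace ℂ H] {ι : Type*}

/-- Families of signs. -/
def IsSign (ε : ι → ℝ) : Prop := ∀ i, ε i = 1 ∨ ε i = -1

/-- Convexity: the cube `[-1, 1]ˢ` is the convex hull of the sign vectors. Concretely, pairing with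
the sum `y` itself, the real part only grows when each `u i` is replaced by the sign of `Re ⟪y, v
i⟫`. -/
theorem norm_sum_smul_le_of_isSign (s : Finset ι) (v : ι → H) (S : ℝ)
    (hS : ∀ ε : ι → ℝ, IsSign ε → ‖∑ i ∈ s, (ε i : ℂ) • v i‖ ≤ S) (u : ι → ℝ)
    (hu : ∀ i ∈ s, |u i| ≤ 1) : ‖∑ i ∈ s, (u i : ℂ) • v i‖ ≤ S := by
  set y := ∑ i ∈ s, (u i : ℂ) • v i with hy
  let c : ι → ℝ := fun i => (inner ℂ y (v i)).re
  let ε : ι → ℝ := fun i => if 0 ≤ c i then 1 else -1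
  have hε : IsSign ε := fun i => by
    by_cases h : 0 ≤ c i <;> simp [ε, h]
  have hre : ∀ a : ι → ℝ, (inner ℂ y (∑ i ∈ s, (a i : ℂ) • v i)).re = ∑ i ∈ s, a i * c i := by
    intro a
    rw [inner_sum, Complex.re_sum]
    refine Finset.sum_congr rfl fun i _ => ?_
    rw [inner_smul_right, Complex.re_ofReal_mul]
  have h1 : ‖y‖ * ‖y‖ ≤ ‖y‖ * S := by
    calc ‖y‖ * ‖y‖ = (inner ℂ y y).re := (inner_self_eq_norm_mul_norm (𝕜 := ℂ) y).symm
      _ = ∑ i ∈ s, u i * c i := hre u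
      _ ≤ ∑ i ∈ s, ε i * c i := by
        refine Finset.sum_le_sum fun i hi => ?_
        have h2 : ε i * c i = |c i| := by
          by_cases h : 0 ≤ c i
          · simp [ε, h, abs_of_nonneg h]
          · simp [ε, h, abs_of_neg (not_le.1 h)]
        rw [h2]
        calc u i * c i ≤ |u i * c i| := le_abs_self _
          _ = |u i| * |c i| := abs_mul _ _
          _ ≤ 1 * |c i| := by gcongr; exact hu i hi
          _ = |c i| := one_mul _
      _ = (inner ℂ y (∑ i ∈ s, (ε i : ℂ) • v i)).re := (hre ε).symm
      _ ≤ ‖y‖ * ‖∑ i ∈ s, (ε i : ℂ) • v i‖ := re_inner_le_norm (𝕜 := ℂ) _ _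
      _ ≤ ‖y‖ * S := by gcongr; exact hS ε hε
  rcases (norm_nonneg y).eq_or_lt with h0 | h0
  · exact h0 ▸ (norm_nonneg _).trans (hS ε hε)
  · exact le_of_mul_le_mul_left h1 h0

theorem exists_isSign_norm_le (s : Finset ι) (v : ι → H) :
    ∃ ε₀ : ι → ℝ, IsSign ε₀ ∧ ∀ ε : ι → ℝ, IsSign ε →
      ‖∑ i ∈ s, (ε i : ℂ) • v i‖ ≤ ‖∑ i ∈ s, (ε₀ i : ℂ) • v i‖ := by
  classical
  let σ : Finset ι → ι → ℝ := fun A i => if i ∈ A then 1 else -1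
  obtain ⟨A, -, hA⟩ := Finset.exists_max_image s.powerset
    (fun A => ‖∑ i ∈ s, (σ A i : ℂ) • v i‖) ⟨∅, Finset.empty_mem_powerset s⟩
  refine ⟨σ A, fun i => ?_, fun ε hε => ?_⟩
  · by_cases h : i ∈ A <;> simp [σ, h]
  · have := hA (s.filter fun i => ε i = 1) (Finset.mem_powerset.2 (Finset.filter_subset _ _))
    refine le_trans (le_of_eq ?_) this
    congr 1
    refine Finset.sum_congr rfl fun i hi => ?_
    rcases hε i with h | h
    · simp [σ, hi, h]
    · have : ¬ ((-1 : ℝ) = 1) := by norm_num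
      simp [σ, hi, h, this]

/-- By the parallelogram law the mean of `‖±a + b‖²` is `‖a‖² + ‖b‖²`, so at each new vector one
sign stays below this mean and one stays above. -/
theorem exists_isSign_norm_sq_le_sum (s : Finset ι) (v : ι → H) :
    (∃ ε : ι → ℝ, IsSign ε ∧ ‖∑ i ∈ s, (ε i : ℂ) • v i‖ ^ 2 ≤ ∑ i ∈ s, ‖v i‖ ^ 2) ∧
      ∃ ε : ι → ℝ, IsSign ε ∧ ∑ i ∈ s, ‖v i‖ ^ 2 ≤ ‖∑ i ∈ s, (ε i : ℂ) • v i‖ ^ 2 := by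
  classical
  have key : ∀ (i : ι) (s : Finset ι), i ∉ s → ∀ (ε : ι → ℝ) (c : ℝ),
      ∑ j ∈ insert i s, (Function.update ε i c j : ℂ) • v j =
        (c : ℂ) • v i + ∑ j ∈ s, (ε j : ℂ) • v j := by
    intro i s hi ε c
    rw [Finset.sum_insert hi, Function.update_self]
    congr 1
    refine Finset.sum_congr rfl fun j hj => ?_
    rw [Function.update_of_ne (ne_of_mem_of_not_mem hj hi)]
  have hupd : ∀ (ε : ι → ℝ) (i : ι) (c : ℝ), IsSign ε → (c = 1 ∨ c = -1) →
      IsSign (Function.update ε i c) := by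
    intro ε i c hε hc j
    by_cases h : j = i
    · subst h; simpa using hc
    · simpa [Function.update_of_ne h] using hε j
  have par : ∀ a b : H, ‖((1 : ℝ) : ℂ) • a + b‖ ^ 2 + ‖((-1 : ℝ) : ℂ) • a + b‖ ^ 2 =
      2 * (‖a‖ ^ 2 + ‖b‖ ^ 2) := by
    intro a b
    have h := parallelogram_law_with_norm ℂ b a
    have e1 : ((1 : ℝ) : ℂ) • a + b = b + a := by simp [add_comm]
    have e2 : ((-1 : ℝ) : ℂ) • a + b = b - a := by simp [sub_eq_neg_add]
    rw [e1, e2]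
    linarith
  induction s using Finset.induction_on with
  | empty => exact ⟨⟨fun _ => 1, fun _ => Or.inl rfl, by simp⟩, ⟨fun _ => 1, fun _ => Or.inl rfl, by simp⟩⟩
  | insert i s hi ih =>
    obtain ⟨⟨ε, hε, h1⟩, ⟨ε', hε', h2⟩⟩ := ih
    rw [Finset.sum_insert hi]
    constructor
    · have hp := par (v i) (∑ j ∈ s, (ε j : ℂ) • v j)
      by_cases h : ‖((1 : ℝ) : ℂ) • v i + ∑ j ∈ s, (ε j : ℂ) • v j‖ ^ 2 ≤
          ‖v i‖ ^ 2 + ‖∑ j ∈ s, (ε j : ℂ) • v j‖ ^ 2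
      · exact ⟨_, hupd ε i 1 hε (Or.inl rfl), by rw [key i s hi]; linarith⟩
      · exact ⟨_, hupd ε i (-1) hε (Or.inr rfl), by rw [key i s hi]; linarith⟩
    · have hp := par (v i) (∑ j ∈ s, (ε' j : ℂ) • v j)
      by_cases h : ‖((1 : ℝ) : ℂ) • v i + ∑ j ∈ s, (ε' j : ℂ) • v j‖ ^ 2 ≤
          ‖v i‖ ^ 2 + ‖∑ j ∈ s, (ε' j : ℂ) • v j‖ ^ 2
      · exact ⟨_, hupd ε' i (-1) hε' (Or.inr rfl), by rw [key i s hi]; linarith⟩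
      · exact ⟨_, hupd ε' i 1 hε' (Or.inl rfl), by rw [key i s hi]; linarith⟩

/-- The lower bound uses signs that make the sum large. The upper bound uses signs that make it
small, with the hypothesis applied to the coefficients `ε i * a i`, which the same signs turn back
into `a i`. -/
theorem norm_sq_bounds_of_isSign (s : Finset ι) (e : ι → H) (C : ℝ)
    (h : ∀ (a : ι → ℂ) (ε : ι → ℝ), IsSign ε →
      ‖∑ i ∈ s, (ε i : ℂ) • a i • e i‖ ≤ C * ‖∑ i ∈ s, a i • e i‖) (a : ι → ℂ) :
    ‖∑ i ∈ s, a i • e i‖ ^ 2 ≤ C ^ 2 * ∑ i ∈ s, ‖a i • e i‖ ^ 2 ∧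
      ∑ i ∈ s, ‖a i • e i‖ ^ 2 ≤ C ^ 2 * ‖∑ i ∈ s, a i • e i‖ ^ 2 := by
  obtain ⟨⟨ε, hε, h1⟩, ⟨ε', hε', h2⟩⟩ := exists_isSign_norm_sq_le_sum s fun i => a i • e i
  constructor
  · have h3 := h (fun i => ε i * a i) ε hε
    have h4 : ∑ i ∈ s, (ε i : ℂ) • ((ε i : ℂ) * a i) • e i = ∑ i ∈ s, a i • e i := by
      refine Finset.sum_congr rfl fun i _ => ?_
      rcases hε i with h | h <;> simp [h]
    have h5 : ∑ i ∈ s, ((ε i : ℂ) * a i) • e i = ∑ i ∈ s, (ε i : ℂ) • a i • e i := by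
      simp [mul_smul]
    rw [h4, h5] at h3
    calc ‖∑ i ∈ s, a i • e i‖ ^ 2 ≤ (C * ‖∑ i ∈ s, (ε i : ℂ) • a i • e i‖) ^ 2 := by gcongr
      _ = C ^ 2 * ‖∑ i ∈ s, (ε i : ℂ) • a i • e i‖ ^ 2 := mul_pow _ _ _
      _ ≤ _ := by gcongr
  · calc ∑ i ∈ s, ‖a i • e i‖ ^ 2 ≤ ‖∑ i ∈ s, (ε' i : ℂ) • a i • e i‖ ^ 2 := h2
      _ ≤ (C * ‖∑ i ∈ s, a i • e i‖) ^ 2 := by gcongr; exact h a ε' hε'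
      _ = _ := mul_pow _ _ _

end Signs

/-! ### Interpolation of signs by Blaschke products -/

section DiscLimit

/-- `g` is, on `[0, 1]`, a pointwise limit of polynomials whose suprema over the closed unit
disc have bounds that tend to `1`. -/
def IsDiscLimit (g : ℝ → ℝ) : Prop :=
  ∃ (P : ℕ → ℂ[X]) (B : ℕ → ℝ), (∀ k, ∀ z : ℂ, ‖z‖ ≤ 1 → ‖(P k).eval z‖ ≤ B k) ∧
    Tendsto B atTop (𝓝 1) ∧
    ∀ x : ℝ, 0 ≤ x → x ≤ 1 → Tendsto (fun k => (P k).eval (x : ℂ)) atTop (𝓝 (g x : ℂ))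

theorem IsDiscLimit.const {c : ℝ} (hc : |c| = 1) : IsDiscLimit fun _ => c :=
  ⟨fun _ => Polynomial.C (c : ℂ), fun _ => 1, fun k z _ => by simp [hc], tendsto_const_nhds,
    fun x _ _ => by simp⟩

theorem IsDiscLimit.mul {f g : ℝ → ℝ} (hf : IsDiscLimit f) (hg : IsDiscLimit g) :
    IsDiscLimit fun x => f x * g x := by
  obtain ⟨P, B, h1, h2, h3⟩ := hf
  obtain ⟨Q, D, k1, k2, k3⟩ := hg
  refine ⟨fun k => P k * Q k, fun k => B k * D k, fun k z hz => ?_, by simpa using h2.mul k2,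
    fun x hx hx' => by simpa using (h3 x hx hx').mul (k3 x hx hx')⟩
  rw [Polynomial.eval_mul, norm_mul]
  exact mul_le_mul (h1 k z hz) (k1 k z hz) (norm_nonneg _) ((norm_nonneg _).trans (h1 k z hz))

theorem IsDiscLimit.prod {ι : Type*} (s : Finset ι) {g : ι → ℝ → ℝ}
    (hg : ∀ i ∈ s, IsDiscLimit (g i)) : IsDiscLimit fun x => ∏ i ∈ s, g i x := by
  classical
  induction s using Finset.induction_on with
  | empty => simpa using IsDiscLimit.const (c := 1) (by simp)
  | insert i s hi ih =>
    simp_rw [Finset.prod_insert hi]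
    exact (hg i (Finset.mem_insert_self _ _)).mul
      (ih fun j hj => hg j (Finset.mem_insert_of_mem hj))

/-- Blaschke factors with a zero at `1 - t`, up to the factor that is positive at `0`. -/
theorem isDiscLimit_blaschke {t : ℝ} (ht : 0 < t) :
    IsDiscLimit fun x => (1 - x - t) / (1 - x + t) := by
  set r : ℝ := 1 / (1 + t) with hr
  have hr0 : 0 < r := by positivity
  have hr1 : r < 1 := by rw [hr, div_lt_one (by positivity)]; linarith
  -- The function equals `1 - 2(1 - r) / (1 - r z)`, with its pole at `1 / r = 1 + t` outside the
  -- disc; `P k` truncates the geometric series. The full function has modulus at most `1` wherever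
  -- `Re z ≤ 1`, and the tail is at most `2 rᵏ` because `|1 - r z| ≥ 1 - r`.
  let P : ℕ → ℂ[X] := fun k =>
    1 - Polynomial.C ((2 * (1 - r) : ℝ) : ℂ) *
      ∑ i ∈ Finset.range k, (Polynomial.C (r : ℂ) * Polynomial.X) ^ i
  have hre : ∀ z : ℂ, ‖z‖ ≤ 1 → 1 - r ≤ (1 - r * z).re := by
    intro z hz
    have := (Complex.re_le_norm z).trans hz
    simp only [Complex.sub_re, Complex.one_re, Complex.re_ofReal_mul]
    nlinarith
  have hne : ∀ z : ℂ, ‖z‖ ≤ 1 → (1 - r * z : ℂ) ≠ 0 := by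
    intro z hz h
    have := hre z hz
    rw [h, Complex.zero_re] at this
    linarith
  have hP : ∀ k, ∀ z : ℂ, ‖z‖ ≤ 1 → (P k).eval z =
      (1 - r * z - (2 * (1 - r) : ℝ)) / (1 - r * z) +
        (2 * (1 - r) : ℝ) * (r * z) ^ k / (1 - r * z) := by
    intro k z hz
    have h := hne z hz
    have hg := geom_sum_mul_neg (r * z : ℂ) k
    have hg' : ∑ i ∈ Finset.range k, (r * z : ℂ) ^ i = (1 - (r * z) ^ k) / (1 - r * z) := by
      rw [eq_div_iff h, hg]
    simp only [P, Polynomial.eval_sub, Polynomial.eval_one, Polynomial.eval_mul,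
      Polynomial.eval_C, Polynomial.eval_finsetSum, Polynomial.eval_pow, Polynomial.eval_X, hg']
    field_simp
    ring
  refine ⟨P, fun k => 1 + 2 * r ^ k, fun k z hz => ?_, ?_, fun x hx hx1 => ?_⟩
  · rw [hP k z hz]
    have hpos : 0 < ‖(1 - r * z : ℂ)‖ := norm_pos_iff.2 (hne z hz)
    have hge : 1 - r ≤ ‖(1 - r * z : ℂ)‖ := (hre z hz).trans (Complex.re_le_norm _)
    refine (norm_add_le _ _).trans (add_le_add ?_ ?_)
    · rw [norm_div, div_le_one hpos]
      refine le_of_sq_le_sq ?_ hpos.le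
      rw [← Complex.normSq_eq_norm_sq, ← Complex.normSq_eq_norm_sq, Complex.normSq_sub,
        Complex.normSq_ofReal, Complex.conj_ofReal, Complex.re_mul_ofReal]
      nlinarith [hre z hz]
    · rw [norm_div, norm_mul, norm_pow, norm_mul, Complex.norm_real, Complex.norm_real,
        Real.norm_of_nonneg (by linarith), Real.norm_of_nonneg hr0.le, div_le_iff₀ hpos]
      have h1 : (r * ‖z‖) ^ k ≤ r ^ k :=
        pow_le_pow_left₀ (by positivity) (mul_le_of_le_one_right hr0.le hz) k
      have h2 : 0 < r ^ k := pow_pos hr0 k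
      have h3 : 0 ≤ 1 - r := by linarith
      calc 2 * (1 - r) * (r * ‖z‖) ^ k ≤ 2 * (1 - r) * r ^ k := by gcongr
        _ = 2 * r ^ k * (1 - r) := by ring
        _ ≤ _ := by gcongr
  · simpa using (tendsto_pow_atTop_nhds_zero_of_lt_one hr0.le hr1).const_mul 2 |>.const_add 1
  · have hx' : ‖(x : ℂ)‖ ≤ 1 := by simpa [abs_of_nonneg hx] using hx1
    have hlim : Tendsto (fun k => (r * x : ℂ) ^ k) atTop (𝓝 0) := by
      refine tendsto_pow_atTop_nhds_zero_of_norm_lt_one ?_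
      rw [norm_mul, Complex.norm_real, Real.norm_of_nonneg hr0.le]
      exact (mul_le_of_le_one_right hr0.le hx').trans_lt hr1
    have hval : (((1 - x - t) / (1 - x + t) : ℝ) : ℂ) =
        (1 - r * x - (2 * (1 - r) : ℝ)) / (1 - r * x) +
          (2 * (1 - r) : ℝ) * 0 / (1 - r * x) := by
      have h1 : 1 - x + t ≠ 0 := by linarith
      have h2 : 1 + t ≠ 0 := by linarith
      have h3 : 1 - r * x ≠ 0 := by nlinarith
      rw [mul_zero, zero_div, add_zero]
      norm_cast
      rw [div_eq_div_iff h1 h3, hr]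
      field_simp
      ring
    rw [hval]
    simp_rw [hP _ _ hx']
    exact ((hlim.const_mul _).div_const _).const_add _

theorem one_sub_sum_le_prod {ι : Type*} (s : Finset ι) (c x : ι → ℝ)
    (h0 : ∀ i ∈ s, 0 ≤ c i) (h1 : ∀ i ∈ s, c i ≤ 1) (hx : ∀ i ∈ s, 1 - x i ≤ c i) :
    1 - ∑ i ∈ s, x i ≤ ∏ i ∈ s, c i := by
  classical
  induction s using Finset.induction_on with
  | empty => simp
  | insert i s hi ih =>
    rw [Finset.sum_insert hi, Finset.prod_insert hi]
    have h0' : ∀ j ∈ s, 0 ≤ c j := fun j hj => h0 j (Finset.mem_insert_of_mem hj)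
    have h1' : ∀ j ∈ s, c j ≤ 1 := fun j hj => h1 j (Finset.mem_insert_of_mem hj)
    have ih := ih h0' h1' fun j hj => hx j (Finset.mem_insert_of_mem hj)
    have hp := Finset.prod_le_one h0' h1'
    have hp0 := Finset.prod_nonneg h0'
    have a0 := h1 i (Finset.mem_insert_self _ _)
    have a1 := hx i (Finset.mem_insert_self _ _)
    nlinarith

theorem geom_sum_hundredth_le (m : ℕ) :
    ∑ i ∈ Finset.range m, (1 / 5 : ℝ) * (1 / 100) ^ i ≤ 20 / 99 := by
  rw [← Finset.mul_sum, geom_sum_eq (by norm_num)]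
  have : (0 : ℝ) < (1 / 100) ^ m := by positivity
  rw [← mul_div_assoc, div_le_iff_of_neg (by norm_num)]
  linarith

/-- A factor with its zero at `1 - t j`, between `1 - δ j` and `1 - δ (j + 1)`, is inserted exactly
when `ε` changes sign there. It is near `1` at the points to the left of its zero and near `-1` at
those to the right, with errors decaying geometrically in the index distance, so the product stays
near the prescribed sign. -/
theorem exists_isDiscLimit_signs (δ : ℕ → ℝ) (hδ : ∀ n, 0 < δ n)
    (hfast : ∀ n, δ (n + 1) ≤ δ n / 100) (ε : ℕ → ℝ) (hε : IsSign ε) (M : ℕ) :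
    ∃ g : ℝ → ℝ, IsDiscLimit g ∧
      ∀ n ≤ M, 1 / 2 ≤ ε n * g (1 - δ n) ∧ ε n * g (1 - δ n) ≤ 1 := by
  have hdec : ∀ n k, δ (n + k) ≤ δ n * (1 / 100) ^ k := by
    intro n k
    induction k with
    | zero => simp
    | succ k ih =>
      have := hfast (n + k)
      rw [← add_assoc, pow_succ]
      linarith
  -- The choice `10 δ (j + 1) ≤ δ j / 10` leaves a factor of `10` on either side. A ratio `ρ ≤
  -- (1/10) (1/100)ⁱ` gives `(1 - ρ) / (1 + ρ) ≥ 1 - 2ρ`, whence the errors `(1/5) (1/100)ⁱ`.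
  let t : ℕ → ℝ := fun j => 10 * δ (j + 1)
  have ht : ∀ j, 0 < t j := fun j => by have := hδ (j + 1); simp only [t]; linarith
  let b : ℕ → ℝ → ℝ := fun j x => (1 - x - t j) / (1 - x + t j)
  let g : ℕ → ℝ → ℝ := fun j x => if ε j = ε (j + 1) then 1 else b j x
  have hεε : ∀ j, ε j * ε (j + 1) = if ε j = ε (j + 1) then 1 else -1 := by
    intro j
    rcases hε j with h | h <;> rcases hε (j + 1) with h' | h' <;> rw [h, h'] <;> norm_num
  have hright : ∀ n i, 1 - (1 / 5) * (1 / 100) ^ i ≤ g (n + i) (1 - δ n) ∧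
      g (n + i) (1 - δ n) ≤ 1 := by
    intro n i
    have hp : (0 : ℝ) < (1 / 100) ^ i := by positivity
    by_cases h : ε (n + i) = ε (n + i + 1)
    · simp only [g, h, if_true]
      constructor <;> linarith
    · have h1 := ht (n + i)
      have h2 := hδ n
      have h3 : t (n + i) ≤ δ n / 10 * (1 / 100) ^ i := by
        have := hdec n (i + 1)
        rw [pow_succ, ← add_assoc] at this
        simp only [t]
        linarith
      simp only [g, h, if_false, b]
      rw [le_div_iff₀ (by linarith), div_le_one (by linarith)]
      constructor
      · nlinarith
      · linarith
  have hleft : ∀ j i, 1 - (1 / 5) * (1 / 100) ^ i ≤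
      ε j * ε (j + 1) * g j (1 - δ (j + 1 + i)) ∧
      ε j * ε (j + 1) * g j (1 - δ (j + 1 + i)) ≤ 1 := by
    intro j i
    have hp : (0 : ℝ) < (1 / 100) ^ i := by positivity
    rw [hεε]
    by_cases h : ε j = ε (j + 1)
    · simp only [g, h, if_true]
      constructor <;> linarith
    · have h1 := ht j
      have h2 := hδ (j + 1 + i)
      have h3 : δ (j + 1 + i) ≤ t j / 10 * (1 / 100) ^ i := by
        have := hdec (j + 1) i
        simp only [t]
        linarith
      simp only [g, h, if_false, b]
      rw [neg_one_mul, ← neg_div, le_div_iff₀ (by linarith), div_le_one (by linarith)]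
      constructor
      · nlinarith
      · linarith
  have hsmall : ∀ i : ℕ, (0 : ℝ) ≤ 1 - (1 / 5) * (1 / 100) ^ i := fun i => by
    have : ((1 : ℝ) / 100) ^ i ≤ 1 := pow_le_one₀ (by norm_num) (by norm_num)
    linarith
  -- Telescoping assigns one sign `ε j * ε (j + 1)` to each factor with `j < n`, whose zero lies to
  -- the left of `1 - δ n`; the factors with `j ≥ n` need no sign.
  have htel : ∀ n, ε n * ε 0 = ∏ j ∈ Finset.range n, ε j * ε (j + 1) := by
    intro n
    induction n with
    | zero => rcases hε 0 with h | h <;> simp [h]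
    | succ n ih =>
      rw [Finset.prod_range_succ, ← ih]
      rcases hε n with h | h <;> rw [h] <;> ring
  refine ⟨fun x => ε 0 * ∏ j ∈ Finset.range M, g j x, ?_, fun n hn => ?_⟩
  · refine (IsDiscLimit.const ?_).mul (IsDiscLimit.prod _ fun j _ => ?_)
    · rcases hε 0 with h | h <;> simp [h]
    · by_cases h : ε j = ε (j + 1)
      · simpa only [g, h, if_true] using IsDiscLimit.const (c := 1) (by simp)
      · simpa only [g, h, if_false] using isDiscLimit_blaschke (ht j)
  · set A := ∏ j ∈ Finset.range n, ε j * ε (j + 1) * g j (1 - δ n) with hA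
    set B := ∏ i ∈ Finset.range (M - n), g (n + i) (1 - δ n) with hB
    have hsplit : ε n * (ε 0 * ∏ j ∈ Finset.range M, g j (1 - δ n)) = A * B := by
      rw [← mul_assoc, htel, ← Finset.prod_range_mul_prod_Ico _ hn,
        Finset.prod_Ico_eq_prod_range, ← mul_assoc,
        ← Finset.prod_mul_distrib]
    have hl : ∀ j ∈ Finset.range n, 1 - (1 / 5) * (1 / 100) ^ (n - 1 - j) ≤
        ε j * ε (j + 1) * g j (1 - δ n) ∧ ε j * ε (j + 1) * g j (1 - δ n) ≤ 1 := by
      intro j hj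
      have hj := Finset.mem_range.1 hj
      have := hleft j (n - 1 - j)
      rwa [show j + 1 + (n - 1 - j) = n by omega] at this
    have hA0 : ∀ j ∈ Finset.range n, 0 ≤ ε j * ε (j + 1) * g j (1 - δ n) :=
      fun j hj => (hsmall _).trans (hl j hj).1
    have hB0 : ∀ i ∈ Finset.range (M - n), 0 ≤ g (n + i) (1 - δ n) :=
      fun i _ => (hsmall _).trans (hright n i).1
    have hA1 : A ≤ 1 := Finset.prod_le_one hA0 fun j hj => (hl j hj).2
    have hB1 : B ≤ 1 := Finset.prod_le_one hB0 fun i _ => (hright n i).2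
    have hA2 := one_sub_sum_le_prod _ _ (fun j => (1 / 5) * (1 / 100) ^ (n - 1 - j)) hA0
      (fun j hj => (hl j hj).2) fun j hj => (hl j hj).1
    have hB2 := one_sub_sum_le_prod _ _ (fun i => (1 / 5) * (1 / 100) ^ i) hB0
      (fun i _ => (hright n i).2) fun i _ => (hright n i).1
    rw [Finset.sum_range_reflect (fun i => (1 / 5 : ℝ) * (1 / 100) ^ i)] at hA2
    have g1 := geom_sum_hundredth_le n
    have g2 := geom_sum_hundredth_le (M - n)
    -- Each side loses at most `20/99`, and `(79/99)² > 1/2`.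
    have hA3 : 79 / 99 ≤ A := by linarith
    have hB3 : 79 / 99 ≤ B := by linarith
    simp only [hsplit]
    constructor <;> nlinarith

end DiscLimit

/-! ### From polynomial boundedness to square-sum estimates -/

section Unconditional

variable {H : Type*} [NormedAddCommGroup H] [InnerProductSpace ℂ H]

theorem aeval_apply_sum_eigenvectors {T : H →L[ℂ] H} {e : ℕ → H} {lam : ℕ → ℝ}
    (hTe : ∀ n, T (e n) = (lam n : ℂ) • e n) (p : ℂ[X]) (s : Finset ℕ) (a : ℕ → ℂ) :
    (Polynomial.aeval T p) (∑ n ∈ s, a n • e n) =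
      ∑ n ∈ s, p.eval (lam n : ℂ) • a n • e n := by
  have hpow : ∀ k n, (T ^ k) (e n) = ((lam n : ℂ) ^ k) • e n := by
    intro k n
    induction k with
    | zero => simp
    | succ k ih => rw [pow_succ, mul_apply_eq_comp, hTe, map_smul, ih, smul_smul, pow_succ']
  rw [map_sum]
  refine Finset.sum_congr rfl fun n _ => ?_
  rw [map_smul, smul_comm]
  congr 1
  induction p using Polynomial.induction_on' with
  | add p q hp hq => simp [hp, hq, add_smul]
  | monomial k c => simp [Polynomial.aeval_monomial, hpow, mul_smul, Algebra.algebraMap_eq_smul_one]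

theorem norm_sum_isDiscLimit_le {T : H →L[ℂ] H} {e : ℕ → H} {lam : ℕ → ℝ}
    (hTe : ∀ n, T (e n) = (lam n : ℂ) • e n) (h0 : ∀ n, 0 ≤ lam n) (h1 : ∀ n, lam n ≤ 1)
    {C : ℝ} (hC : ∀ p : ℂ[X],
      ‖Polynomial.aeval T p‖ ≤ C * ⨆ z : Metric.closedBall (0 : ℂ) 1, ‖p.eval (z : ℂ)‖)
    {g : ℝ → ℝ} (hg : IsDiscLimit g) (s : Finset ℕ) (a : ℕ → ℂ) :
    ‖∑ n ∈ s, (g (lam n) : ℂ) • a n • e n‖ ≤ |C| * ‖∑ n ∈ s, a n • e n‖ := by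
  obtain ⟨P, B, hPB, hB, hlim⟩ := hg
  have hl : Tendsto (fun k => ‖∑ n ∈ s, (P k).eval (lam n : ℂ) • a n • e n‖) atTop
      (𝓝 ‖∑ n ∈ s, (g (lam n) : ℂ) • a n • e n‖) :=
    (tendsto_finsetSum _ fun n _ => (hlim (lam n) (h0 n) (h1 n)).smul_const _).norm
  have hr : Tendsto (fun k => |C| * B k * ‖∑ n ∈ s, a n • e n‖) atTop
      (𝓝 (|C| * 1 * ‖∑ n ∈ s, a n • e n‖)) := (hB.const_mul _).mul_const _
  rw [mul_one] at hr
  refine le_of_tendsto_of_tendsto' hl hr fun k => ?_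
  rw [← aeval_apply_sum_eigenvectors hTe]
  have hne : Nonempty (Metric.closedBall (0 : ℂ) 1) := ⟨⟨0, by simp⟩⟩
  refine (ContinuousLinearMap.le_opNorm _ _).trans ?_
  refine mul_le_mul_of_nonneg_right ((hC (P k)).trans ?_) (norm_nonneg _)
  have hsup0 : 0 ≤ ⨆ z : Metric.closedBall (0 : ℂ) 1, ‖(P k).eval (z : ℂ)‖ :=
    Real.iSup_nonneg fun _ => norm_nonneg _
  have hsup : ⨆ z : Metric.closedBall (0 : ℂ) 1, ‖(P k).eval (z : ℂ)‖ ≤ B k :=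
    ciSup_le fun z => hPB k z (mem_closedBall_zero_iff.1 z.2)
  exact (mul_le_mul_of_nonneg_right (le_abs_self C) hsup0).trans
    (mul_le_mul_of_nonneg_left hsup (abs_nonneg C))

/-- Interpolation reaches a sign pattern only up to error `1/2`. For signs that maximise the norm
`S`, the error vector is half a combination with coefficients in `[-1, 1]`, hence at most `S / 2`.
So `S ≤ |C| ‖x‖ + S / 2`, and the error is absorbed. -/
theorem norm_sum_isSign_le {T : H →L[ℂ] H} {e : ℕ → H} {lam : ℕ → ℝ}
    (hTe : ∀ n, T (e n) = (lam n : ℂ) • e n) (h0 : ∀ n, 0 ≤ lam n) (h1 : ∀ n, lam n < 1)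
    (hfast : ∀ n, 1 - lam (n + 1) ≤ (1 - lam n) / 100)
    {C : ℝ} (hC : ∀ p : ℂ[X],
      ‖Polynomial.aeval T p‖ ≤ C * ⨆ z : Metric.closedBall (0 : ℂ) 1, ‖p.eval (z : ℂ)‖)
    (M : ℕ) (a : ℕ → ℂ) (ε : ℕ → ℝ) (hε : IsSign ε) :
    ‖∑ n ∈ Finset.range M, (ε n : ℂ) • a n • e n‖ ≤
      2 * |C| * ‖∑ n ∈ Finset.range M, a n • e n‖ := by
  obtain ⟨ε₀, hε₀, hmax⟩ := exists_isSign_norm_le (Finset.range M) fun n => a n • e n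
  refine (hmax ε hε).trans ?_
  obtain ⟨g, hg, hgε⟩ := exists_isDiscLimit_signs (fun n => 1 - lam n)
    (fun n => sub_pos.2 (h1 n)) hfast ε₀ hε₀ M
  simp only [sub_sub_cancel] at hgε
  set S := ‖∑ n ∈ Finset.range M, (ε₀ n : ℂ) • a n • e n‖ with hS
  let u : ℕ → ℝ := fun n => 2 * (ε₀ n - g (lam n))
  have hu : ∀ n ∈ Finset.range M, |u n| ≤ 1 := by
    intro n hn
    have h := hgε n (Finset.mem_range.1 hn).le
    simp only [u, abs_le]
    rcases hε₀ n with h' | h' <;> rw [h'] at h ⊢ <;> constructor <;> linarith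
  have h2 := norm_sum_smul_le_of_isSign _ _ S hmax u hu
  have h3 := norm_sum_isDiscLimit_le hTe h0 (fun n => (h1 n).le) hC hg (Finset.range M) a
  have h4 : ∑ n ∈ Finset.range M, (ε₀ n : ℂ) • a n • e n =
      ∑ n ∈ Finset.range M, (g (lam n) : ℂ) • a n • e n +
        (1 / 2 : ℂ) • ∑ n ∈ Finset.range M, (u n : ℂ) • a n • e n := by
    rw [Finset.smul_sum, ← Finset.sum_add_distrib]
    refine Finset.sum_congr rfl fun n _ => ?_
    rw [smul_smul (1 / 2 : ℂ), ← add_smul]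
    congr 1
    simp only [u]
    push_cast
    ring
  have h5 := norm_add_le (∑ n ∈ Finset.range M, (g (lam n) : ℂ) • a n • e n)
    ((1 / 2 : ℂ) • ∑ n ∈ Finset.range M, (u n : ℂ) • a n • e n)
  have h6 : ‖(1 / 2 : ℂ)‖ = 1 / 2 := by norm_num
  rw [← h4, ← hS, norm_smul, h6] at h5
  linarith

theorem IsPolynomiallyBounded.exists_norm_sq_bounds {T : H →L[ℂ] H} {e : ℕ → H} {lam : ℕ → ℝ}
    (hT : IsPolynomiallyBounded T) (hTe : ∀ n, T (e n) = (lam n : ℂ) • e n)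
    (h0 : ∀ n, 0 ≤ lam n) (h1 : ∀ n, lam n < 1)
    (hfast : Tendsto (fun k => (1 - lam (k + 1)) / (1 - lam k)) atTop (𝓝 0)) :
    ∃ K : ℝ, ∃ N : ℕ, ∀ (M : ℕ) (a : ℕ → ℂ),
      ‖∑ n ∈ Finset.range M, a n • e (N + n)‖ ^ 2 ≤
          K * ∑ n ∈ Finset.range M, ‖a n • e (N + n)‖ ^ 2 ∧
        ∑ n ∈ Finset.range M, ‖a n • e (N + n)‖ ^ 2 ≤
          K * ‖∑ n ∈ Finset.range M, a n • e (N + n)‖ ^ 2 := by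
  obtain ⟨C, hC⟩ := hT
  -- Interpolation needs ratios at most `1/100`, which hold only from some `N` on; finitely many
  -- initial exponentials are dropped.
  obtain ⟨N, hN⟩ := eventually_atTop.1 (hfast.eventually_le_const (by norm_num : (0 : ℝ) < 1 / 100))
  refine ⟨(2 * |C|) ^ 2, N, fun M a => norm_sq_bounds_of_isSign _ (fun n => e (N + n)) _
    (fun a ε hε => norm_sum_isSign_le (fun n => hTe (N + n)) (fun n => h0 (N + n))
      (fun n => h1 (N + n)) (fun n => ?_) hC M a ε hε) a⟩
  have := hN (N + n) (Nat.le_add_right _ _)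
  rw [div_le_iff₀ (sub_pos.2 (h1 _))] at this
  rw [← add_assoc]
  linarith

end Unconditional

/-! ### Riesz bases and similarity -/

section Similarity

variable {H : Type*} [NormedAddCommGroup H] [InnerProductSpace ℂ H]

theorem norm_sq_linearCombination_of_orthonormal {ι : Type*} {f : ι → H} (hf : Orthonormal ℂ f)
    (a : ι →₀ ℂ) : ‖Finsupp.linearCombination ℂ f a‖ ^ 2 = ∑ i ∈ a.support, ‖a i‖ ^ 2 := by
  have h1 : (inner ℂ (Finsupp.linearCombination ℂ f a) (Finsupp.linearCombination ℂ f a)).re =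
      ∑ i ∈ a.support, ‖a i‖ ^ 2 := by
    rw [hf.inner_finsupp_eq_sum_left, Finsupp.sum, Complex.re_sum]
    refine Finset.sum_congr rfl fun i _ => ?_
    rw [Complex.conj_mul', ← Complex.ofReal_pow, Complex.ofReal_re]
  rw [← h1]
  exact (inner_self_eq_norm_sq (𝕜 := ℂ) _).symm

/-- A diagonal operator with entries in the unit disc, with respect to a Riesz basis, is similar
to a contraction. -/
theorem isSimilarToContraction_of_rieszBasis [CompleteSpace H] {T : H →L[ℂ] H} {e : ℕ → H}
    {lam : ℕ → ℝ} (hdense : (Submodule.span ℂ (Set.range e)).topologicalClosure = ⊤)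
    (hTe : ∀ n, T (e n) = (lam n : ℂ) • e n) (hlam : ∀ n, |lam n| ≤ 1) (K : ℝ)
    (hK : ∀ (s : Finset ℕ) (a : ℕ → ℂ),
      ‖∑ n ∈ s, a n • e n‖ ^ 2 ≤ K * ∑ n ∈ s, ‖a n‖ ^ 2 ∧
        ∑ n ∈ s, ‖a n‖ ^ 2 ≤ K * ‖∑ n ∈ s, a n • e n‖ ^ 2) :
    IsSimilarToContraction T := by
  have hli : LinearIndependent ℂ e := by
    rw [linearIndependent_iff']
    intro s a h i hi
    have h1 := (hK s a).2
    rw [h, norm_zero] at h1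
    have h2 := Finset.single_le_sum (f := fun n => ‖a n‖ ^ 2) (fun n _ => sq_nonneg _) hi
    have h3 : ‖a i‖ ^ 2 ≤ 0 := by simpa using h2.trans h1
    simpa using h3
  -- Gram–Schmidt serves only to supply an orthonormal sequence, indexed by `ℕ`, with dense span.
  -- The isomorphism `A` sends `f n` to `e n`, so `A⁻¹ T A` is diagonal on `f` with entries `lam n`.
  set f := InnerProductSpace.gramSchmidtNormed ℂ e with hf
  have hfo : Orthonormal ℂ f := InnerProductSpace.gramSchmidtNormed_orthonormal hli
  have hfspan : Submodule.span ℂ (Set.range f) = Submodule.span ℂ (Set.range e) := by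
    rw [hf, InnerProductSpace.span_gramSchmidtNormed_range, InnerProductSpace.span_gramSchmidt]
  set E := Finsupp.linearCombination ℂ e with hE
  set F := Finsupp.linearCombination ℂ f with hF
  have hEd : DenseRange E := by
    rw [DenseRange, ← LinearMap.coe_range, hE, Finsupp.range_linearCombination,
      ← Submodule.dense_iff_topologicalClosure_eq_top] at *
    exact hdense
  have hFd : DenseRange F := by
    rw [DenseRange, ← LinearMap.coe_range, hF, Finsupp.range_linearCombination, hfspan,
      Submodule.dense_iff_topologicalClosure_eq_top]
    exact hdense
  have hsq : ∀ a : ℕ →₀ ℂ, ‖E a‖ ^ 2 ≤ |K| * ‖F a‖ ^ 2 ∧ ‖F a‖ ^ 2 ≤ |K| * ‖E a‖ ^ 2 := by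
    intro a
    rw [norm_sq_linearCombination_of_orthonormal hfo]
    obtain ⟨h1, h2⟩ := hK a.support a
    have h3 : E a = ∑ n ∈ a.support, a n • e n := Finsupp.linearCombination_apply _ _
    rw [h3]
    refine ⟨h1.trans ?_, h2.trans ?_⟩ <;> gcongr <;> exact le_abs_self K
  have hroot : ∀ x y : ℝ, 0 ≤ x → 0 ≤ y → x ^ 2 ≤ |K| * y ^ 2 → x ≤ √|K| * y := by
    intro x y _ hy h
    refine le_of_sq_le_sq ?_ (by positivity)
    rwa [mul_pow, Real.sq_sqrt (abs_nonneg K)]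
  have hEF : ∃ C, ∀ a, ‖E (LinearEquiv.refl ℂ (ℕ →₀ ℂ) a)‖ ≤ C * ‖F a‖ :=
    ⟨_, fun a => hroot _ _ (norm_nonneg _) (norm_nonneg _) (hsq a).1⟩
  have hFE : ∃ C, ∀ a, ‖F ((LinearEquiv.refl ℂ (ℕ →₀ ℂ)).symm a)‖ ≤ C * ‖E a‖ :=
    ⟨_, fun a => hroot _ _ (norm_nonneg _) (norm_nonneg _) (hsq a).2⟩
  let A : H ≃L[ℂ] H := (LinearEquiv.refl ℂ (ℕ →₀ ℂ)).extend F E hFd hEF hEd hFE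
  have hA : ∀ a, A (F a) = E a := fun a =>
    LinearMap.extendOfNorm_eq hFd hEF a
  refine ⟨A, ContinuousLinearMap.opNorm_le_bound _ zero_le_one fun x => ?_⟩
  rw [one_mul]
  refine hFd.induction_on (p := fun x =>
    ‖((A.symm : H →L[ℂ] H) ∘L T ∘L (A : H →L[ℂ] H)) x‖ ≤ ‖x‖) x
    (isClosed_le (by fun_prop) (by fun_prop)) fun a => ?_
  let b : ℕ →₀ ℂ := Finsupp.onFinset a.support (fun n => (lam n : ℂ) * a n) fun n hn => by
    rw [Finsupp.mem_support_iff]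
    exact right_ne_zero_of_mul hn
  have hb : ∀ g : ℕ → H, Finsupp.linearCombination ℂ g b =
      ∑ n ∈ a.support, ((lam n : ℂ) * a n) • g n := fun g => by
    rw [Finsupp.linearCombination_apply]
    exact Finsupp.onFinset_sum _ fun n => zero_smul ℂ (g n)
  have hTE : T (E a) = E b := by
    rw [hE, hb, Finsupp.linearCombination_apply, Finsupp.sum, map_sum]
    refine Finset.sum_congr rfl fun n _ => ?_
    rw [map_smul, hTe, smul_smul, mul_comm]
  have hcomp : ((A.symm : H →L[ℂ] H) ∘L T ∘L (A : H →L[ℂ] H)) (F a) = F b := by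
    simp only [ContinuousLinearMap.comp_apply, ContinuousLinearEquiv.coe_coe]
    rw [hA, hTE, ← hA, A.symm_apply_apply]
  rw [hcomp]
  refine le_of_sq_le_sq ?_ (norm_nonneg _)
  rw [norm_sq_linearCombination_of_orthonormal hfo, norm_sq_linearCombination_of_orthonormal hfo]
  refine (Finset.sum_le_sum_of_subset_of_nonneg Finsupp.support_onFinset_subset
    fun _ _ _ => sq_nonneg _).trans (Finset.sum_le_sum fun n _ => ?_)
  gcongr
  simp only [b, Finsupp.onFinset_apply, norm_mul, Complex.norm_real, Real.norm_eq_abs]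
  exact mul_le_of_le_one_left (norm_nonneg _) (hlam n)

end Similarity

/-! ### Comparison of measures through trigonometric polynomials -/

section Comparison

theorem norm_sq_toLp (μ : Measure CircleT) [IsFiniteMeasure μ] (f : C(CircleT, ℂ)) :
    ‖ContinuousMap.toLp 2 μ ℂ f‖ ^ 2 = ∫ θ, ‖f θ‖ ^ 2 ∂μ := by
  have h1 := inner_self_eq_norm_sq_to_K (𝕜 := ℂ) (ContinuousMap.toLp 2 μ ℂ f)
  rw [ContinuousMap.inner_toLp] at h1
  have h2 : ∀ θ, f θ * (starRingEnd ℂ) (f θ) = ((‖f θ‖ ^ 2 : ℝ) : ℂ) := fun θ => by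
    rw [Complex.mul_conj', Complex.ofReal_pow]
  simp_rw [h2] at h1
  rw [integral_complex_ofReal] at h1
  refine Complex.ofReal_injective ?_
  rw [Complex.ofReal_pow]
  exact h1.symm

theorem integral_norm_sq_le_of_span_fourier (μ ν : Measure CircleT) [IsFiniteMeasure μ]
    [IsFiniteMeasure ν] (K : ℝ)
    (h : ∀ f ∈ Submodule.span ℂ (Set.range (fourier : ℤ → C(CircleT, ℂ))),
      ∫ θ, ‖f θ‖ ^ 2 ∂μ ≤ K * ∫ θ, ‖f θ‖ ^ 2 ∂ν) (f : C(CircleT, ℂ)) :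
    ∫ θ, ‖f θ‖ ^ 2 ∂μ ≤ K * ∫ θ, ‖f θ‖ ^ 2 ∂ν := by
  have hd : Dense (Submodule.span ℂ (Set.range (fourier : ℤ → C(CircleT, ℂ))) :
      Set C(CircleT, ℂ)) := by
    rw [Submodule.dense_iff_topologicalClosure_eq_top]
    exact span_fourier_closure_eq_top
  simp_rw [← norm_sq_toLp] at h ⊢
  exact hd.induction (P := fun f => ‖ContinuousMap.toLp 2 μ ℂ f‖ ^ 2 ≤
      K * ‖ContinuousMap.toLp 2 ν ℂ f‖ ^ 2) h (isClosed_le (by fun_prop) (by fun_prop)) f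

/-- For a closed set, thickened indicators `g` decrease to the indicator and satisfy `g² ≤ g`, so
they serve as test functions. Inner regularity by closed sets gives the rest. -/
theorem measure_le_of_integral_norm_sq_le (μ ν : Measure CircleT) [IsFiniteMeasure μ]
    [IsFiniteMeasure ν] (K : ℝ) (hK : 0 ≤ K)
    (h : ∀ f : C(CircleT, ℂ), ∫ θ, ‖f θ‖ ^ 2 ∂μ ≤ K * ∫ θ, ‖f θ‖ ^ 2 ∂ν)
    {s : Set CircleT} (hs : MeasurableSet s) : μ s ≤ ENNReal.ofReal K * ν s := by
  have hclosed : ∀ F : Set CircleT, IsClosed F → μ.real F ≤ K * ν.real F := by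
    intro F hF
    have hδ : ∀ n : ℕ, (0 : ℝ) < 1 / (n + 1) := fun n => Nat.one_div_pos_of_nat
    have hlim := tendsto_integral_thickenedIndicator_of_isClosed ν hF hδ
      tendsto_one_div_add_atTop_nhds_zero_nat
    refine ge_of_tendsto' (hlim.const_mul K) fun n => ?_
    set g := thickenedIndicator (hδ n) F with hg
    let f : C(CircleT, ℂ) := ⟨fun θ => ((g θ : ℝ) : ℂ), by fun_prop⟩
    have hf : ∀ θ, ‖f θ‖ ^ 2 = (g θ : ℝ) ^ 2 := fun θ => by simp [f]
    have hint : Integrable (fun θ => ‖f θ‖ ^ 2) μ :=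
      (by fun_prop : Continuous fun θ => ‖f θ‖ ^ 2).integrable_of_hasCompactSupport
        (HasCompactSupport.of_compactSpace _)
    calc μ.real F = ∫ θ, F.indicator 1 θ ∂μ := (integral_indicator_one hF.measurableSet).symm
      _ ≤ ∫ θ, ‖f θ‖ ^ 2 ∂μ := by
        refine integral_mono ((integrable_const 1).indicator hF.measurableSet) hint fun θ => ?_
        by_cases hθ : θ ∈ F
        · have h1 : g θ = 1 := thickenedIndicator_one (hδ n) F hθ
          simp [hf, hθ, h1]
        · simp [hθ]
      _ ≤ K * ∫ θ, ‖f θ‖ ^ 2 ∂ν := h f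
      _ ≤ K * ∫ θ, (g θ : ℝ) ∂ν := by
        refine mul_le_mul_of_nonneg_left ?_ hK
        refine integral_mono_of_nonneg (Eventually.of_forall fun θ => sq_nonneg _)
          (integrable_thickenedIndicator F (hδ n)) (Eventually.of_forall fun θ => ?_)
        have h1 : (g θ : ℝ) ≤ 1 := NNReal.coe_le_one.2 (thickenedIndicator_le_one (hδ n) F θ)
        simp only [hf]
        nlinarith [(g θ).coe_nonneg]
  rw [hs.measure_eq_iSup_isClosed_of_ne_top (measure_ne_top μ s)]
  refine iSup_le fun F => iSup_le fun hFs => iSup_le fun hF => ?_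
  calc μ F = ENNReal.ofReal (μ.real F) := by rw [ofReal_measureReal]
    _ ≤ ENNReal.ofReal (K * ν.real F) := ENNReal.ofReal_le_ofReal (hclosed F hF)
    _ = ENNReal.ofReal K * ν F := by rw [ENNReal.ofReal_mul hK, ofReal_measureReal]
    _ ≤ ENNReal.ofReal K * ν s := by gcongr

/-- A trigonometric polynomial becomes a combination of exponentials of large frequency after
multiplication by an exponential. -/
theorem exists_fourier_mul_eq_sum {f : C(CircleT, ℂ)}
    (hf : f ∈ Submodule.span ℂ (Set.range (fourier : ℤ → C(CircleT, ℂ)))) (N : ℕ) :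
    ∃ (m : ℤ) (M : ℕ) (a : ℕ → ℂ), fourier m * f =
      ∑ n ∈ Finset.range M, a n • (fourier ((N + n : ℕ) : ℤ) : C(CircleT, ℂ)) := by
  obtain ⟨c, rfl⟩ := Finsupp.mem_span_range_iff_exists_finsupp.1 hf
  obtain ⟨B, hB⟩ : ∃ B : ℕ, ∀ k ∈ c.support, k.natAbs ≤ B :=
    ⟨c.support.sup Int.natAbs, fun k hk => Finset.le_sup (f := Int.natAbs) hk⟩
  have hinj : Function.Injective fun n : ℕ => (n : ℤ) - B := fun x y h => by
    simpa using h
  -- The frequencies lie in `[-B, B]`; the shift by `N + B` moves them to `[N, N + 2B]`.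
  refine ⟨N + B, 2 * B + 1, fun n => c (n - B), ?_⟩
  have h1 : c.sum (fun k a => a • (fourier k : C(CircleT, ℂ))) =
      ∑ k ∈ (Finset.range (2 * B + 1)).image fun n : ℕ => (n : ℤ) - B, c k • fourier k := by
    refine Finset.sum_subset (fun k hk => ?_) fun k _ hk => ?_
    · have := hB k hk
      refine Finset.mem_image.2 ⟨(k + B).toNat, Finset.mem_range.2 ?_, ?_⟩ <;> omega
    · simp only [Finsupp.notMem_support_iff.1 hk, zero_smul]
  rw [h1, Finset.sum_image fun x _ y _ h => hinj h, Finset.mul_sum]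
  refine Finset.sum_congr rfl fun n _ => ?_
  rw [mul_smul_comm]
  congr 1
  ext θ
  rw [ContinuousMap.mul_apply, ← fourier_add]
  congr 2
  push_cast
  ring

end Comparison

/-! ### Exponentials in weighted spaces and equivalence of weights -/

namespace Weight

theorem coe_sum_smul_expH2 (w : Weight) (s : Finset ℕ) (a : ℕ → ℂ) (k : ℕ → ℕ) :
    ((∑ n ∈ s, a n • w.expH2 (k n) : w.H2) : w.L2) =
      ContinuousMap.toLp 2 w.measure ℂ (∑ n ∈ s, a n • fourier (k n : ℤ)) := by
  simp [expH2, expL2]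

theorem norm_sq_sum_smul_expH2 (w : Weight) (s : Finset ℕ) (a : ℕ → ℂ) (k : ℕ → ℕ) :
    ‖∑ n ∈ s, a n • w.expH2 (k n)‖ ^ 2 =
      ∫ θ, ‖(∑ n ∈ s, a n • fourier (k n : ℤ) : C(CircleT, ℂ)) θ‖ ^ 2 ∂w.measure := by
  rw [← norm_sq_toLp, ← coe_sum_smul_expH2, Submodule.coe_norm]

theorem norm_sq_expH2 (w : Weight) (n : ℕ) : ‖w.expH2 n‖ ^ 2 = w.measure.real Set.univ := by
  have h := w.norm_sq_sum_smul_expH2 {n} (fun _ => 1) id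
  have h1 : ∀ θ : CircleT, ‖(fourier (n : ℤ) θ : ℂ)‖ = 1 := fun θ => by
    rw [fourier_apply]; exact Circle.norm_coe _
  simpa [-fourier_apply, h1] using h

theorem measure_univ_pos (w : Weight) : 0 < w.measure.real Set.univ := by
  rw [measureReal_def, ENNReal.toReal_pos_iff]
  refine ⟨?_, measure_lt_top _ _⟩
  rw [measure, withDensity_apply _ MeasurableSet.univ, setLIntegral_univ, pos_iff_ne_zero, Ne,
    lintegral_eq_zero_iff' w.integrable.1.aemeasurable.ennreal_ofReal]
  intro h
  refine w.pos.ne' (measure_mono_null (fun θ hθ => ?_) (ae_iff.1 h))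
  simpa using hθ

theorem integral_norm_sq_sum_fourier (s : Finset ℕ) (a : ℕ → ℂ) {k : ℕ → ℕ}
    (hk : Function.Injective k) :
    ∫ θ, ‖(∑ n ∈ s, a n • fourier (k n : ℤ) : C(CircleT, ℂ)) θ‖ ^ 2
      ∂(haarAddCircle : Measure CircleT) = ∑ n ∈ s, ‖a n‖ ^ 2 := by
  have hj : Function.Injective fun n => (k n : ℤ) := Nat.cast_injective.comp hk
  have h := integral_norm_sq_trigPoly (s.image fun n => (k n : ℤ))
    (fun l => a (Function.invFun (fun n => (k n : ℤ)) l))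
  rw [Finset.sum_image fun x _ y _ h => hj h] at h
  simp_rw [Finset.sum_image fun x _ y _ h => hj h, Function.leftInverse_invFun hj _] at h
  rw [← h]
  simp [mul_comm]

/-- Multiplication by an exponential moves `f` into the span of the `e (N + n)` without changing
`|f|`, so estimates on this tail suffice. All exponentials have the same norm squared in `L²(w)`,
the total mass of `w`, which produces the constants. -/
theorem integral_norm_sq_bounds_of_expH2 (w : Weight) {K : ℝ} {N : ℕ}
    (h : ∀ (M : ℕ) (a : ℕ → ℂ),
      ‖∑ n ∈ Finset.range M, a n • w.expH2 (N + n)‖ ^ 2 ≤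
          K * ∑ n ∈ Finset.range M, ‖a n • w.expH2 (N + n)‖ ^ 2 ∧
        ∑ n ∈ Finset.range M, ‖a n • w.expH2 (N + n)‖ ^ 2 ≤
          K * ‖∑ n ∈ Finset.range M, a n • w.expH2 (N + n)‖ ^ 2)
    {f : C(CircleT, ℂ)}
    (hf : f ∈ Submodule.span ℂ (Set.range (fourier : ℤ → C(CircleT, ℂ)))) :
    ∫ θ, ‖f θ‖ ^ 2 ∂w.measure ≤
        K * w.measure.real Set.univ * ∫ θ, ‖f θ‖ ^ 2 ∂haarAddCircle ∧
      ∫ θ, ‖f θ‖ ^ 2 ∂haarAddCircle ≤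
        K / w.measure.real Set.univ * ∫ θ, ‖f θ‖ ^ 2 ∂w.measure := by
  obtain ⟨m, M, a, hfa⟩ := exists_fourier_mul_eq_sum hf N
  have hnorm : ∀ θ, ‖f θ‖ =
      ‖(∑ n ∈ Finset.range M, a n • fourier ((N + n : ℕ) : ℤ) : C(CircleT, ℂ)) θ‖ := fun θ => by
    have : ‖(fourier m θ : ℂ)‖ = 1 := by rw [fourier_apply]; exact Circle.norm_coe _
    rw [← hfa, ContinuousMap.mul_apply, norm_mul, this, one_mul]
  have hpos := w.measure_univ_pos
  have h' := h M a
  simp_rw [norm_smul, mul_pow, norm_sq_expH2, ← Finset.sum_mul] at h'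
  rw [w.norm_sq_sum_smul_expH2 _ a fun n => N + n,
    ← integral_norm_sq_sum_fourier (Finset.range M) a (add_right_injective N)] at h'
  simp_rw [← hnorm] at h'
  refine ⟨by linarith [h'.1], ?_⟩
  rw [div_mul_eq_mul_div, le_div_iff₀ hpos]
  exact h'.2

theorem equivalent_one_of_measure_le (w : Weight) {K : ℝ}
    (h1 : ∀ s, MeasurableSet s → w.measure s ≤ ENNReal.ofReal K * haarAddCircle s)
    (h2 : ∀ s, MeasurableSet s → haarAddCircle s ≤ ENNReal.ofReal K * w.measure s) :
    w.Equivalent 1 := by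
  have hm : AEMeasurable (fun θ => ENNReal.ofReal (w θ)) haarAddCircle :=
    w.integrable.1.aemeasurable.ennreal_ofReal
  have hup : ∀ᵐ θ ∂haarAddCircle, ENNReal.ofReal (w θ) ≤ ENNReal.ofReal K := by
    refine ae_le_of_forall_setLIntegral_le_of_sigmaFinite₀ hm fun s hs _ => ?_
    rw [setLIntegral_const]
    simpa [measure, withDensity_apply _ hs] using h1 s hs
  have hlow : ∀ᵐ θ ∂haarAddCircle, 1 ≤ ENNReal.ofReal K * ENNReal.ofReal (w θ) := by
    refine ae_le_of_forall_setLIntegral_le_of_sigmaFinite₀ aemeasurable_const fun s hs _ => ?_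
    rw [setLIntegral_const, one_mul, lintegral_const_mul' _ _ ENNReal.ofReal_ne_top]
    simpa [measure, withDensity_apply _ hs] using h2 s hs
  have hb : ∀ᵐ θ ∂haarAddCircle, 0 < w θ ∧ w θ ≤ K ∧ 1 ≤ K * w θ := by
    filter_upwards [hup, hlow] with θ hu hl
    have hK : 0 < K := by
      by_contra hK
      rw [ENNReal.ofReal_of_nonpos (not_lt.1 hK), zero_mul] at hl
      exact absurd hl (by simp)
    have hw : 0 < w θ := by
      by_contra hw
      rw [ENNReal.ofReal_of_nonpos (not_lt.1 hw), mul_zero] at hl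
      exact absurd hl (by simp)
    refine ⟨hw, (ENNReal.ofReal_le_ofReal_iff hK.le).1 hu, ?_⟩
    rwa [← ENNReal.ofReal_mul hK.le, ENNReal.one_le_ofReal] at hl
  have hwm : AEMeasurable w.toFun haarAddCircle := w.integrable.1.aemeasurable
  have hone : ∀ θ, (1 : Weight) θ = 1 := fun _ => rfl
  refine ⟨?_, ?_, ?_⟩
  · filter_upwards [hb] with θ hθ
    simp [hone, hθ.1.ne']
  · refine memLp_top_of_bound (by simpa [hone] using hwm.aestronglyMeasurable) K ?_
    filter_upwards [hb] with θ hθ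
    rw [hone, div_one, Real.norm_of_nonneg hθ.1.le]
    exact hθ.2.1
  · refine memLp_top_of_bound (by simpa [hone, Pi.inv_def] using hwm.inv.aestronglyMeasurable) K ?_
    filter_upwards [hb] with θ hθ
    rw [hone, norm_div, norm_one, Real.norm_of_nonneg hθ.1.le, div_le_iff₀ hθ.1]
    exact hθ.2.2

theorem Equivalent.exists_measure_le {w : Weight} (h : w.Equivalent 1) :
    ∃ K : ℝ, w.measure ≤ ENNReal.ofReal K • (haarAddCircle : Measure CircleT) ∧
      (haarAddCircle : Measure CircleT) ≤ ENNReal.ofReal K • w.measure := by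
  obtain ⟨h0, h1, h2⟩ := h
  have hone : ∀ θ, (1 : Weight) θ = 1 := fun _ => rfl
  have b1 := ae_le_eLpNormEssSup (f := fun θ => w θ / (1 : Weight) θ)
    (μ := (haarAddCircle : Measure CircleT))
  have b2 := ae_le_eLpNormEssSup (f := fun θ => (1 : Weight) θ / w θ)
    (μ := (haarAddCircle : Measure CircleT))
  have c1 := h1.2
  have c2 := h2.2
  rw [eLpNorm_exponent_top] at c1 c2
  set S₁ := eLpNormEssSup (fun θ => w θ / (1 : Weight) θ) (haarAddCircle : Measure CircleT)
  set S₂ := eLpNormEssSup (fun θ => (1 : Weight) θ / w θ) (haarAddCircle : Measure CircleT)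
  refine ⟨max S₁.toReal S₂.toReal, ?_, ?_⟩
  · rw [← withDensity_const, measure]
    refine withDensity_mono ?_
    filter_upwards [b1, w.nonneg] with θ hθ hw
    rw [hone, div_one, Real.enorm_of_nonneg hw] at hθ
    refine (hθ.trans_eq (ENNReal.ofReal_toReal c1.ne).symm).trans ?_
    exact ENNReal.ofReal_le_ofReal (le_max_left _ _)
  · rw [measure, ← withDensity_smul' _ _ ENNReal.ofReal_ne_top]
    conv_lhs => rw [← withDensity_one (μ := (haarAddCircle : Measure CircleT))]
    refine withDensity_mono ?_
    filter_upwards [b2, w.nonneg, h0] with θ hθ hw hw0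
    -- Since `1 / 0 = 0`, the bound on `1 / w` says nothing where `w` vanishes; the clause on common
    -- zeros excludes this almost everywhere.
    have hpos : 0 < w θ := hw.lt_of_ne fun h => by simpa [hone] using hw0.1 h.symm
    rw [hone, Real.enorm_of_nonneg (by positivity)] at hθ
    have hle : ENNReal.ofReal (1 / w θ) ≤ ENNReal.ofReal (max S₁.toReal S₂.toReal) := by
      refine (hθ.trans_eq (ENNReal.ofReal_toReal c2.ne).symm).trans ?_
      exact ENNReal.ofReal_le_ofReal (le_max_right _ _)
    calc (1 : ℝ≥0∞) = ENNReal.ofReal (1 / w θ) * ENNReal.ofReal (w θ) := by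
          rw [← ENNReal.ofReal_mul (by positivity), one_div_mul_cancel hpos.ne',
            ENNReal.ofReal_one]
      _ ≤ _ := by simpa using mul_le_mul_left hle (ENNReal.ofReal (w θ))

theorem integral_norm_sq_le_of_measure_le {μ ν : Measure CircleT} [IsFiniteMeasure ν] {K : ℝ}
    (hK : 0 ≤ K) (h : μ ≤ ENNReal.ofReal K • ν) (f : C(CircleT, ℂ)) :
    ∫ θ, ‖f θ‖ ^ 2 ∂μ ≤ K * ∫ θ, ‖f θ‖ ^ 2 ∂ν := by
  have hint : Integrable (fun θ => ‖f θ‖ ^ 2) ν :=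
    (by fun_prop : Continuous fun θ => ‖f θ‖ ^ 2).integrable_of_hasCompactSupport
      (HasCompactSupport.of_compactSpace _)
  have h1 := integral_mono_measure h (Eventually.of_forall fun θ => sq_nonneg ‖f θ‖)
    (hint.smul_measure ENNReal.ofReal_ne_top)
  rwa [integral_smul_measure, ENNReal.toReal_ofReal hK, smul_eq_mul] at h1

theorem Equivalent.exists_rieszBasis_bounds {w : Weight} (h : w.Equivalent 1) :
    ∃ K : ℝ, ∀ (s : Finset ℕ) (a : ℕ → ℂ),
      ‖∑ n ∈ s, a n • w.expH2 n‖ ^ 2 ≤ K * ∑ n ∈ s, ‖a n‖ ^ 2 ∧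
        ∑ n ∈ s, ‖a n‖ ^ 2 ≤ K * ‖∑ n ∈ s, a n • w.expH2 n‖ ^ 2 := by
  obtain ⟨K, h1, h2⟩ := h.exists_measure_le
  have hK : ENNReal.ofReal K ≤ ENNReal.ofReal |K| := ENNReal.ofReal_le_ofReal (le_abs_self K)
  have h1' : w.measure ≤ ENNReal.ofReal |K| • (haarAddCircle : Measure CircleT) :=
    h1.trans (by gcongr)
  have h2' : (haarAddCircle : Measure CircleT) ≤ ENNReal.ofReal |K| • w.measure :=
    h2.trans (by gcongr)
  refine ⟨|K|, fun s a => ?_⟩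
  rw [w.norm_sq_sum_smul_expH2 s a fun n => n,
    ← integral_norm_sq_sum_fourier s a Function.injective_id]
  exact ⟨integral_norm_sq_le_of_measure_le (abs_nonneg K) h1' _,
    integral_norm_sq_le_of_measure_le (abs_nonneg K) h2' _⟩

theorem topologicalClosure_span_expH2 (w : Weight) :
    (Submodule.span ℂ (Set.range w.expH2)).topologicalClosure = ⊤ := by
  rw [← Submodule.dense_iff_topologicalClosure_eq_top]
  intro x
  rw [closure_subtype]
  have hx : (x : w.L2) ∈ closure
      (Submodule.span ℂ (Set.range fun n : ℕ => w.expL2 n) : Set w.L2) := x.2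
  refine closure_mono (fun y hy => ?_) hx
  have hmap : (Submodule.span ℂ (Set.range w.expH2)).map w.H2.subtype =
      Submodule.span ℂ (Set.range fun n : ℕ => w.expL2 n) := by
    rw [Submodule.map_span, ← Set.range_comp]
    rfl
  rw [← hmap] at hy
  exact hy

end Weight

/-! ### Diagonal action of the multiplier and the equivalence -/

theorem IsMonotoneMultiplier.apply_eq {H : Type*} [NormedAddCommGroup H] [NormedSpace ℂ H]
    {e : ℕ → H} {lam : ℕ → ℝ} {T : H →L[ℂ] H} (hT : IsMonotoneMultiplier e lam T) (n : ℕ) :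
    T (e n) = (lam n : ℂ) • e n := by
  have key : ∀ (c : ℂ), Tendsto
      (fun m => ∑ k ∈ Finset.range m, (if k = n then c else 0) • e k) atTop (𝓝 (c • e n)) := by
    intro c
    refine tendsto_const_nhds.congr' ?_
    filter_upwards [eventually_gt_atTop n] with m hm
    simp [ite_smul, hm]
  have h1 := hT.map_series _ _ (key 1)
  rw [one_smul] at h1
  refine tendsto_nhds_unique h1 ((key (lam n)).congr fun m => ?_)
  refine Finset.sum_congr rfl fun k _ => ?_
  by_cases h : k = n <;> simp [h]

theorem mainTheorem4 (w : Weight) (hw : w.IsA2) (lam : ℕ → ℝ) (T : w.H2 →L[ℂ] w.H2)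
    (hT : IsFastMonotoneMultiplier w.expH2 lam T) :
    List.TFAE [IsSimilarToContraction T, IsPolynomiallyBounded T, w.Equivalent 1] := by
  have hTe := hT.toIsMonotoneMultiplier.apply_eq
  tfae_have 1 → 2 := fun h => h.isPolynomiallyBounded
  tfae_have 2 → 3 := fun h => by
    obtain ⟨K, N, hK⟩ := h.exists_norm_sq_bounds hTe hT.nonneg hT.lt_one hT.fast
    set W := w.measure.real Set.univ
    -- One nonnegative constant for both inequalities; absolute values are taken because the sign of
    -- `K` is not known.
    let K' := max |K * W| |K / W|
    have hK' : 0 ≤ K' := (abs_nonneg _).trans (le_max_left _ _)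
    refine w.equivalent_one_of_measure_le (K := K') (fun s hs => ?_) fun s hs => ?_
    · refine measure_le_of_integral_norm_sq_le _ _ K' hK'
        (integral_norm_sq_le_of_span_fourier _ _ _ fun f hf =>
          (w.integral_norm_sq_bounds_of_expH2 hK hf).1.trans ?_) hs
      gcongr
      exact (le_abs_self _).trans (le_max_left _ _)
    · refine measure_le_of_integral_norm_sq_le _ _ K' hK'
        (integral_norm_sq_le_of_span_fourier _ _ _ fun f hf =>
          (w.integral_norm_sq_bounds_of_expH2 hK hf).2.trans ?_) hs
      gcongr
      exact (le_abs_self _).trans (le_max_right _ _)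
  tfae_have 3 → 1 := fun h => by
    have : CompleteSpace w.H2 :=
      (Submodule.isClosed_topologicalClosure _).completeSpace_coe
    obtain ⟨K, hK⟩ := h.exists_rieszBasis_bounds
    refine isSimilarToContraction_of_rieszBasis w.topologicalClosure_span_expH2 hTe
      (fun n => ?_) K hK
    rw [abs_of_nonneg (hT.nonneg n)]
    exact hT.le_one n
  tfae_finish
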